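/- All graphs are simple. For graphs $X$ and $Y$ on the same number $n$ of vertices, $\mathsf{FS}(X,Y)$ is the graph whose vertices are the bijections $\sigma\colon V(X)\to V(Y)$, in which $\sigma$ and $\sigma'$ are adjacent if and only if there is an edge $\{a,b\}\in E(X)$ such that $\{\sigma(a),\sigma(b)\}\in E(Y)$, $\sigma'(a)=\sigma(b)$, $\sigma'(b)=\sigma(a)$, and $\sigma'(c)=\sigma(c)$ for all $c\in V(X)\setminus\{a,b\}$. For $k\ge 2$, a $k$-bridge in a graph is a path $v_1,v_2,\ldots,v_k$ of $k$ distinct vertices such that every edge of the path is a cut-edge of the graph, $v_2,\ldots,v_{k-1}$ have degree $2$ in the graph, and neither $v_1$ nor $v_k$ has degree $1$ in the graph; a $1$-bridge is a cut-vertex. Let $K_{k_1,\ldots,k_t}$ denote the complete $t$-partite graph with partition classes of sizes $k_1,\ldots,k_t$. **Theorem.** Suppose $t>2$ and $1\le k_1\le\cdots\le k_t$ are integers, where $n=k_1+\cdots+k_t\ge 4$. Let $X$ be a graph on $n$ vertices. If $X$ is a tree and does not contain an $(n-k_t)$-bridge, then $\mathsf{FS}(X,K_{k_1,\ldots,k_t})$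 is connected. -/

import Mathlib

/-- The friends-and-strangers graph `FS(X, Y)`: its vertices are the bijections `V(X) → V(Y)`, and
`σ`, `τ` are adjacent when `τ` arises from `σ` by an `(X, Y)`-friendly swap across an edge
`{a, b}` of `X`. -/
def FS {V W : Type*} (X : SimpleGraph V) (Y : SimpleGraph W) : SimpleGraph (V ≃ W) where
  Adj σ τ := ∃ a b : V, X.Adj a b ∧ Y.Adj (σ a) (σ b) ∧
    σ a = τ b ∧ σ b = τ a ∧ ∀ c : V, c ≠ a → c ≠ b → σ c = τ c
  symm := by
    constructor
    rintro σ τ ⟨a, b, hX, hY, hab, hba, hc⟩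
    refine ⟨a, b, hX, ?_, hba.symm, hab.symm, fun c h₁ h₂ => (hc c h₁ h₂).symm⟩
    rw [← hab, ← hba]
    exact hY.symm
  loopless := by
    constructor
    rintro σ ⟨a, b, hX, -, hab, -⟩
    exact hX.ne (σ.injective hab)

/-- A cut-vertex: some two other vertices in the same connected component of `G` lie in different
connected components once `v` is deleted. -/
def IsCutVertex {V : Type*} (G : SimpleGraph V) (v : V) : Prop :=
  ∃ (a b : V) (ha : a ≠ v) (hb : b ≠ v), G.Reachable a b ∧
    ¬ (G.induce {x : V | x ≠ v}).Reachable ⟨a, ha⟩ ⟨b, hb⟩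

/-- `G` contains a `k`-bridge. For `k ≥ 2` this is a path on `k` vertices, all of whose edges are
cut-edges, whose interior vertices have degree 2 in `G` and whose ends do not have degree 1 in `G`;
a 1-bridge is a cut-vertex. There is no 0-bridge. -/
def ContainsBridge {V : Type*} [Fintype V] (G : SimpleGraph V) [DecidableRel G.Adj]
    (k : ℕ) : Prop :=
  (k = 1 ∧ ∃ v : V, IsCutVertex G v) ∨
  (2 ≤ k ∧ ∃ (u v : V) (p : G.Walk u v), p.IsPath ∧ p.support.length = k ∧
    (∀ e ∈ p.edges, G.IsBridge e) ∧
    (∀ x ∈ p.support, x ≠ u → x ≠ v → G.degree x = 2) ∧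
    G.degree u ≠ 1 ∧ G.degree v ≠ 1)

/-! Think of vertices of `X` as seats, vertices of `Y` as people, partition classes as classes of
people; people of different classes are friends. Transpositions along the edges of a connected graph
generate all permutations of seats, so it suffices to exchange any two people of one class `i`, from
every arrangement, with everybody else back in place (`preconnected_of_reachable_swap`).

Call the `m` people outside class `i` outsiders, and suppose they all sit in a connected set `T` of
`m + 2` seats that contains a claw. Then `T` holds just two people of class `i`. As long as only
classes matter, seats in `T` can be permuted freely (`exists_reachable_recolour`), so these two can
be brought to two leaves of the claw, with outsiders of different classes at the centre and the
third leaf; `claw_exchange` finishes. Two such sets sharing `m + 1` seats have a person of class `i`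
in common, so exchanges compose along chains of such sets (`reachable_swap_of_chain`).

It remains to reach every vertex of the tree by a chain (`exists_chain_of_adj`). The only obstacle
is a `T` consisting of a path on `m` vertices and two further neighbours of one end. Since `m` is at
least the forbidden bridge length, the path branches at an interior vertex, and the claw can be
moved there. -/

namespace FriendsStrangers

open SimpleGraph

/-! ### Transpositions and the exchange in a claw -/

section Swaps

variable {V W : Type*} {X : SimpleGraph V} {Y : SimpleGraph W}

lemma adj_swap_trans [DecidableEq V] {σ : V ≃ W} {a b : V} (hX : X.Adj a b)
    (hY : Y.Adj (σ a) (σ b)) : (FS X Y).Adj σ ((Equiv.swap a b).trans σ) :=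
  ⟨a, b, hX, hY, by simp, by simp, fun c ha hb => by simp [Equiv.swap_apply_of_ne_of_ne ha hb]⟩

/-- A property of permutations that is closed under products and holds for the transpositions along
the edges of `X` inside a connected set `R` holds for every permutation supported in `R`. -/
lemma perm_induction_of_preconnected [Finite V] [DecidableEq V] {R : Set V}
    (hR : (X.induce R).Preconnected) {P : Equiv.Perm V → Prop} (h1 : P 1)
    (hmul : ∀ π ρ, P π → P ρ → P (π * ρ))
    (hadj : ∀ a ∈ R, ∀ b ∈ R, X.Adj a b → P (Equiv.swap a b))
    (π : Equiv.Perm V) (hπ : ∀ x ∉ R, π x = x) : P π := by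
  classical
  have hswap : ∀ a b : R, P (Equiv.swap (a : V) b) := by
    intro a b
    obtain ⟨p⟩ := hR a b
    induction p with
    | nil => rw [Equiv.swap_self]; exact h1
    | @cons u v w huv p ih =>
      have huv' : X.Adj (u : V) v := huv
      by_cases huw : (u : V) = w
      · rw [huw, Equiv.swap_self]; exact h1
      by_cases hvw : (v : V) = w
      · rw [← hvw]; exact hadj _ u.2 _ v.2 huv'
      -- Conjugating `(v w)` by `(u v)` gives `(u w)`.
      have := hmul _ _ (hmul _ _ (hadj _ u.2 _ v.2 huv') ih) (hadj _ u.2 _ v.2 huv')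
      rwa [Equiv.swap_comm (u : V) v, Equiv.swap_comm (v : V) w,
        Equiv.swap_mul_swap_mul_swap (Ne.symm hvw) (Ne.symm huw)] at this
  have key : ∀ ρ : Equiv.Perm R, P (Equiv.Perm.ofSubtype ρ) := by
    intro ρ
    induction ρ using Equiv.Perm.swap_induction_on with
    | one => rw [map_one]; exact h1
    | swap_mul ρ a b hab ih =>
      rw [map_mul, Equiv.Perm.ofSubtype_swap_eq]
      exact hmul _ _ (hswap a b) ih
  have hmem : ∀ x, x ∈ R ↔ π x ∈ R := by
    intro x
    constructor
    · intro hx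
      by_contra h
      exact h (by rwa [π.injective (hπ _ h)])
    · intro hx
      by_contra h
      exact h (by rwa [hπ x h] at hx)
  have := key (π.subtypePerm fun x => (hmem x).symm)
  rwa [Equiv.Perm.ofSubtype_subtypePerm] at this
  intro x hx
  by_contra h
  exact hx (hπ x h)

/-- Two people sitting in a claw together with two further people, where all pairs except possibly
the first two are friends, can exchange their seats. -/
lemma claw_exchange [DecidableEq W] {σ : V ≃ W} {x a₁ a₂ a₃ : V}
    (h₁ : X.Adj x a₁) (h₂ : X.Adj x a₂) (h₃ : X.Adj x a₃)
    (h₁₂ : a₁ ≠ a₂) (h₁₃ : a₁ ≠ a₃) (h₂₃ : a₂ ≠ a₃)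
    (hp₁ : Y.Adj (σ x) (σ a₁)) (hp₂ : Y.Adj (σ x) (σ a₂)) (hpq : Y.Adj (σ x) (σ a₃))
    (hq₁ : Y.Adj (σ a₃) (σ a₁)) (hq₂ : Y.Adj (σ a₃) (σ a₂)) :
    (FS X Y).Reachable σ (σ.trans (Equiv.swap (σ a₁) (σ a₂))) := by
  classical
  let P : W → W → W → W → Prop := fun p u v q =>
    ∃ τ : V ≃ W, (FS X Y).Reachable σ τ ∧ τ x = p ∧ τ a₁ = u ∧ τ a₂ = v ∧ τ a₃ = q ∧
      ∀ c, c ≠ x → c ≠ a₁ → c ≠ a₂ → c ≠ a₃ → τ c = σ c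
  have s1 : ∀ {p u v q}, P p u v q → Y.Adj p u → P u p v q := by
    rintro p u v q ⟨τ, hτ, rfl, rfl, rfl, rfl, hc⟩ h
    refine ⟨_, hτ.trans (adj_swap_trans h₁ h).reachable, by simp, by simp, ?_, ?_, ?_⟩
    · simp [Equiv.swap_apply_of_ne_of_ne h₂.ne' h₁₂.symm]
    · simp [Equiv.swap_apply_of_ne_of_ne h₃.ne' h₁₃.symm]
    · intro c c0 c1 c2 c3
      simp [Equiv.swap_apply_of_ne_of_ne c0 c1, hc c c0 c1 c2 c3]
  have s2 : ∀ {p u v q}, P p u v q → Y.Adj p v → P v u p q := by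
    rintro p u v q ⟨τ, hτ, rfl, rfl, rfl, rfl, hc⟩ h
    refine ⟨_, hτ.trans (adj_swap_trans h₂ h).reachable, by simp, ?_, by simp, ?_, ?_⟩
    · simp [Equiv.swap_apply_of_ne_of_ne h₁.ne' h₁₂]
    · simp [Equiv.swap_apply_of_ne_of_ne h₃.ne' h₂₃.symm]
    · intro c c0 c1 c2 c3
      simp [Equiv.swap_apply_of_ne_of_ne c0 c2, hc c c0 c1 c2 c3]
  have s3 : ∀ {p u v q}, P p u v q → Y.Adj p q → P q u v p := by
    rintro p u v q ⟨τ, hτ, rfl, rfl, rfl, rfl, hc⟩ h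
    refine ⟨_, hτ.trans (adj_swap_trans h₃ h).reachable, by simp, ?_, ?_, by simp, ?_⟩
    · simp [Equiv.swap_apply_of_ne_of_ne h₁.ne' h₁₃]
    · simp [Equiv.swap_apply_of_ne_of_ne h₂.ne' h₂₃]
    · intro c c0 c1 c2 c3
      simp [Equiv.swap_apply_of_ne_of_ne c0 c3, hc c c0 c1 c2 c3]
  have h0 : P (σ x) (σ a₁) (σ a₂) (σ a₃) :=
    ⟨σ, .refl _, rfl, rfl, rfl, rfl, fun _ _ _ _ _ => rfl⟩
  -- The seats `a₁, a₃, a₁, a₂, a₁, a₃, a₂` trade in turn with the centre; the people from `a₁` and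
  -- `a₂` never trade with each other.
  obtain ⟨τ, hτ, e0, e1, e2, e3, hc⟩ := s2 (s3 (s1 (s2 (s1 (s3 (s1 h0 hp₁) hq₁.symm) hpq.symm)
    hp₂) hq₂.symm) hq₁) hp₁.symm
  have : τ = σ.trans (Equiv.swap (σ a₁) (σ a₂)) := by
    ext c
    by_cases c1 : c = a₁
    · subst c1; simp [e1]
    by_cases c2 : c = a₂
    · subst c2; simp [e2]
    rw [Equiv.trans_apply, Equiv.swap_apply_of_ne_of_ne (σ.injective.ne c1) (σ.injective.ne c2)]
    by_cases c0 : c = x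
    · rw [c0, e0]
    by_cases c3 : c = a₃
    · rw [c3, e3]
    exact hc c c0 c1 c2 c3
  exact this ▸ hτ

end Swaps

lemma exists_perm_of_four {V : Type*} {T : Set V} {a b c d a' b' c' d' : V}
    (ha : a ∈ T) (hb : b ∈ T) (hc : c ∈ T) (hd : d ∈ T)
    (ha' : a' ∈ T) (hb' : b' ∈ T) (hc' : c' ∈ T) (hd' : d' ∈ T)
    (hab : a ≠ b) (hac : a ≠ c) (had : a ≠ d) (hbc : b ≠ c) (hbd : b ≠ d) (hcd : c ≠ d)
    (hab' : a' ≠ b') (hac' : a' ≠ c') (had' : a' ≠ d') (hbc' : b' ≠ c') (hbd' : b' ≠ d')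
    (hcd' : c' ≠ d') :
    ∃ π : Equiv.Perm V, π a = a' ∧ π b = b' ∧ π c = c' ∧ π d = d' ∧ ∀ x ∉ T, π x = x := by
  classical
  have inj : ∀ {p q r s : T}, p ≠ q → p ≠ r → p ≠ s → q ≠ r → q ≠ s → r ≠ s →
      Function.Injective ![p, q, r, s] := by
    intro p q r s h1 h2 h3 h4 h5 h6 i j hij
    fin_cases i <;> fin_cases j <;> simp_all
  have i1 := @inj ⟨a, ha⟩ ⟨b, hb⟩ ⟨c, hc⟩ ⟨d, hd⟩ (by simpa) (by simpa) (by simpa) (by simpa)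
    (by simpa) (by simpa)
  have i2 := @inj ⟨a', ha'⟩ ⟨b', hb'⟩ ⟨c', hc'⟩ ⟨d', hd'⟩ (by simpa) (by simpa) (by simpa)
    (by simpa) (by simpa) (by simpa)
  obtain ⟨π, hπ⟩ := (Equiv.Perm.isMultiplyPretransitive T 4).exists_smul_eq ⟨_, i1⟩ ⟨_, i2⟩
  have h := fun k => DFunLike.congr_fun hπ k
  refine ⟨Equiv.Perm.ofSubtype π, ?_, ?_, ?_, ?_,
    fun x hx => Equiv.Perm.ofSubtype_apply_of_not_mem π hx⟩
  · rw [Equiv.Perm.ofSubtype_apply_of_mem π ha]; exact congrArg Subtype.val (h 0)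
  · rw [Equiv.Perm.ofSubtype_apply_of_mem π hb]; exact congrArg Subtype.val (h 1)
  · rw [Equiv.Perm.ofSubtype_apply_of_mem π hc]; exact congrArg Subtype.val (h 2)
  · rw [Equiv.Perm.ofSubtype_apply_of_mem π hd]; exact congrArg Subtype.val (h 3)

/-! ### Rearrangement up to classes, and exchanges within a class -/

section Colour

variable {V W ι : Type*} {X : SimpleGraph V} {Y : SimpleGraph W} {col : W → ι}

/-- Seats inside a connected set can be permuted at will, if only the classes of the people
matter. -/
lemma exists_reachable_recolour [Finite V] (hY : ∀ p q, col p ≠ col q → Y.Adj p q)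
    {R : Set V} (hR : (X.induce R).Preconnected) (π : Equiv.Perm V) (hπ : ∀ x ∉ R, π x = x)
    (σ : V ≃ W) :
    ∃ τ : V ≃ W, (FS X Y).Reachable σ τ ∧ (∀ x ∉ R, τ x = σ x) ∧
      ∀ x, col (τ x) = col (σ (π x)) := by
  classical
  revert σ
  refine perm_induction_of_preconnected (P := fun π => ∀ σ : V ≃ W, ∃ τ : V ≃ W,
    (FS X Y).Reachable σ τ ∧ (∀ x ∉ R, τ x = σ x) ∧ ∀ x, col (τ x) = col (σ (π x)))
    hR ?_ ?_ ?_ π hπ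
  · exact fun σ => ⟨σ, .refl _, fun _ _ => rfl, fun _ => rfl⟩
  · intro π ρ h1 h2 σ
    obtain ⟨τ, r, f, g⟩ := h1 σ
    obtain ⟨τ', r', f', g'⟩ := h2 τ
    exact ⟨τ', r.trans r', fun x hx => (f' x hx).trans (f x hx), fun x => by
      rw [g', g, Equiv.Perm.mul_apply]⟩
  · intro a ha b hb hab σ
    by_cases hc : col (σ a) = col (σ b)
    -- Two people of one class need not move: the pattern of classes is already the required one.
    · refine ⟨σ, .refl _, fun _ _ => rfl, fun x => ?_⟩
      rw [Equiv.swap_apply_def]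
      split_ifs with h1 h2
      · rw [h1, hc]
      · rw [h2, hc]
      · rfl
    · refine ⟨_, (adj_swap_trans hab (hY _ _ hc)).reachable, fun x hx => ?_, fun x => rfl⟩
      rw [Equiv.trans_apply, Equiv.swap_apply_of_ne_of_ne] <;> rintro rfl <;> contradiction

variable [DecidableEq W]

/-- Renaming people within a class is an automorphism of `Y`, so it acts on `FS X Y`. -/
lemma reachable_trans_swap (hY : ∀ p q, Y.Adj p q ↔ col p ≠ col q) {u v : W}
    (huv : col u = col v) {σ τ : V ≃ W} (h : (FS X Y).Reachable σ τ) :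
    (FS X Y).Reachable (σ.trans (Equiv.swap u v)) (τ.trans (Equiv.swap u v)) := by
  have hcol : ∀ w, col (Equiv.swap u v w) = col w := by
    intro w
    rw [Equiv.swap_apply_def]
    split_ifs with h1 h2
    · rw [h1, huv]
    · rw [h2, huv]
    · rfl
  let f : FS X Y →g FS X Y := ⟨fun σ => σ.trans (Equiv.swap u v), by
    rintro σ τ ⟨a, b, hX, hab, h1, h2, h3⟩
    refine ⟨a, b, hX, ?_, ?_, ?_, fun c ha hb => ?_⟩
    · simpa only [hY, Equiv.trans_apply, hcol] using hab
    · simp [h1]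
    · simp [h2]
    · simp [h3 c ha hb]⟩
  exact h.map f

/-- Walk to `τ`, exchange there, and walk back with the names `u` and `v` interchanged.
Exchangeability may thus be tested at any convenient arrangement in the component. -/
lemma reachable_swap_of_reachable (hY : ∀ p q, Y.Adj p q ↔ col p ≠ col q) {u v : W}
    (huv : col u = col v) {σ τ : V ≃ W} (h : (FS X Y).Reachable σ τ)
    (hτ : (FS X Y).Reachable τ (τ.trans (Equiv.swap u v))) :
    (FS X Y).Reachable σ (σ.trans (Equiv.swap u v)) :=
  (h.trans hτ).trans (reachable_trans_swap hY huv h).symm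

/-- `(u w)` is the product `(u v)(v w)(u v)`, and each factor can be realised after renaming within
the class. -/
lemma reachable_swap_trans (hY : ∀ p q, Y.Adj p q ↔ col p ≠ col q) {u v w : W}
    (huv : col u = col v) (hvw : col v = col w) {σ : V ≃ W}
    (h₁ : (FS X Y).Reachable σ (σ.trans (Equiv.swap u v)))
    (h₂ : (FS X Y).Reachable σ (σ.trans (Equiv.swap v w))) :
    (FS X Y).Reachable σ (σ.trans (Equiv.swap u w)) := by
  by_cases hne : u = w
  · subst hne
    simp
  by_cases hne' : u = v
  · rwa [hne']
  by_cases hne'' : w = v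
  · rwa [hne'']
  have h := (h₁.trans (reachable_trans_swap hY huv h₂)).trans
    (reachable_trans_swap hY huv (reachable_trans_swap hY hvw h₁))
  convert h using 1
  rw [← Equiv.swap_mul_swap_mul_swap hne'' (Ne.symm hne)]
  ext x
  simp [Equiv.swap_comm]

/-- If a connected set `T` holds exactly two people of one class, has a vertex with three
neighbours, and holds people of two further classes, then the two people can be exchanged. -/
lemma reachable_swap_of_claw [Finite V] (hY : ∀ p q, Y.Adj p q ↔ col p ≠ col q) {T : Set V}
    (hT : (X.induce T).Preconnected) {x a₁ a₂ a₃ : V} (hx : x ∈ T) (ha₁ : a₁ ∈ T)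
    (ha₂ : a₂ ∈ T) (ha₃ : a₃ ∈ T) (h₁ : X.Adj x a₁) (h₂ : X.Adj x a₂) (h₃ : X.Adj x a₃)
    (h₁₂ : a₁ ≠ a₂) (h₁₃ : a₁ ≠ a₃) (h₂₃ : a₂ ≠ a₃) {σ : V ≃ W} {i : ι} {yu yv yp yq : V}
    (hyu : yu ∈ T) (hyv : yv ∈ T) (hyp : yp ∈ T) (hyq : yq ∈ T) (huv : yu ≠ yv)
    (hu : col (σ yu) = i) (hv : col (σ yv) = i) (hp : col (σ yp) ≠ i) (hq : col (σ yq) ≠ i)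
    (hpq : col (σ yp) ≠ col (σ yq)) (honly : ∀ y ∈ T, col (σ y) = i → y = yu ∨ y = yv) :
    (FS X Y).Reachable σ (σ.trans (Equiv.swap (σ yu) (σ yv))) := by
  have hne : ∀ {y z}, col (σ y) = i → col (σ z) ≠ i → y ≠ z := by
    rintro y z h h' rfl
    exact h' h
  obtain ⟨π, e1, e2, e0, e3, hπ⟩ := exists_perm_of_four ha₁ ha₂ hx ha₃ hyu hyv hyp hyq h₁₂ h₁.ne'
    h₁₃ h₂.ne' h₂₃ h₃.ne huv (hne hu hp) (hne hu hq) (hne hv hp) (hne hv hq)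
    (fun h => hpq (by rw [h]))
  obtain ⟨τ, hτ, hout, hcol⟩ := exists_reachable_recolour (fun p q h => (hY p q).2 h) hT π hπ σ
  have hmem : ∀ a ∈ T, col (τ a) = i → τ a = σ yu ∨ τ a = σ yv := by
    intro a ha hc
    have h : σ.symm (τ a) ∈ T := by
      by_contra h
      have h2 := hout _ h
      rw [Equiv.apply_symm_apply] at h2
      exact h (by rwa [τ.injective h2])
    rcases honly _ h (by simpa) with h | h
    · left; rw [← h]; simp
    · right; rw [← h]; simp
  have c0 := hcol x
  have c1 := hcol a₁
  have c2 := hcol a₂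
  have c3 := hcol a₃
  rw [e0] at c0
  rw [e1, hu] at c1
  rw [e2, hv] at c2
  rw [e3] at c3
  have key := claw_exchange (σ := τ) (Y := Y) h₁ h₂ h₃ h₁₂ h₁₃ h₂₃
    ((hY _ _).2 (by rwa [c0, c1])) ((hY _ _).2 (by rwa [c0, c2]))
    ((hY _ _).2 (by rwa [c0, c3])) ((hY _ _).2 (by rwa [c3, c1]))
    ((hY _ _).2 (by rwa [c3, c2]))
  refine reachable_swap_of_reachable hY (hu.trans hv.symm) hτ ?_
  have hne' : τ a₁ ≠ τ a₂ := τ.injective.ne h₁₂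
  -- Recolouring controls classes only, so the two people may occupy the leaves in either order; the
  -- other two cases put one person in two seats.
  rcases hmem a₁ ha₁ c1 with h | h <;> rcases hmem a₂ ha₂ c2 with h' | h' <;> rw [h, h'] at key
  · exact absurd (h.trans h'.symm) hne'
  · exact key
  · rwa [Equiv.swap_comm] at key
  · exact absurd (h.trans h'.symm) hne'

end Colour

/-! ### Exchanges in forked sets and along chains of them -/

/-- A connected set of `k` vertices that is not a path: some vertex of `T` has three neighbours
in `T`. -/
def IsForked {V : Type*} (X : SimpleGraph V) (k : ℕ) (T : Finset V) : Prop :=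
  T.card = k ∧ (X.induce (T : Set V)).Connected ∧ ∃ x ∈ T, ∃ a₁ ∈ T, ∃ a₂ ∈ T, ∃ a₃ ∈ T,
    X.Adj x a₁ ∧ X.Adj x a₂ ∧ X.Adj x a₃ ∧ a₁ ≠ a₂ ∧ a₁ ≠ a₃ ∧ a₂ ≠ a₃

/-- Two forked sets that differ in a single vertex. -/
def ForkedStep {V : Type*} [DecidableEq V] (X : SimpleGraph V) (k : ℕ) (T T' : Finset V) : Prop :=
  IsForked X k T ∧ IsForked X k T' ∧ (T ∩ T').card + 1 = k

section Propagation

variable {V W ι : Type*} [Fintype V] [Fintype W] [DecidableEq ι]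
  {X : SimpleGraph V} {Y : SimpleGraph W} {col : W → ι} {i : ι} {m : ℕ}

lemma card_filter_col_ne (hm : (Finset.univ.filter fun w => col w ≠ i).card = m) (σ : V ≃ W) :
    (Finset.univ.filter fun x => col (σ x) ≠ i).card = m := by
  rw [← hm]
  exact Finset.card_equiv σ (by simp)

lemma exists_col_eq_of_lt_card (hm : (Finset.univ.filter fun w => col w ≠ i).card = m)
    (σ : V ≃ W) {S : Finset V} (hS : m < S.card) : ∃ z ∈ S, col (σ z) = i := by
  by_contra! h
  have : S ⊆ Finset.univ.filter fun x => col (σ x) ≠ i := fun x hx => by simp [h x hx]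
  have := Finset.card_le_card this
  rw [card_filter_col_ne hm] at this
  omega

variable [DecidableEq V] [DecidableEq W]

/-- All `m` outsiders sit in `T`, so only two of its `m + 2` seats are left to class `i`, as the
claw argument requires. -/
lemma reachable_swap_of_mem_isForked (hY : ∀ p q, Y.Adj p q ↔ col p ≠ col q)
    (hm : (Finset.univ.filter fun w => col w ≠ i).card = m)
    (hpq : ∃ p q, col p ≠ i ∧ col q ≠ i ∧ col p ≠ col q) {T : Finset V}
    (hT : IsForked X (m + 2) T) {σ : V ≃ W} (hσ : ∀ x ∉ T, col (σ x) = i) {y z : V}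
    (hy : y ∈ T) (hz : z ∈ T) (hyi : col (σ y) = i) (hzi : col (σ z) = i) :
    (FS X Y).Reachable σ (σ.trans (Equiv.swap (σ y) (σ z))) := by
  by_cases hyz : y = z
  · subst hyz; simp
  obtain ⟨hcard, hconn, x, hx, a₁, ha₁, a₂, ha₂, a₃, ha₃, h₁, h₂, h₃, h₁₂, h₁₃, h₂₃⟩ := hT
  obtain ⟨p, q, hp, hq, hne⟩ := hpq
  have hmem : ∀ w, col w ≠ i → σ.symm w ∈ T := by
    intro w hw
    by_contra h
    exact hw (by simpa using hσ _ h)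
  have hfil : T.filter (fun x => col (σ x) ≠ i) = Finset.univ.filter fun x => col (σ x) ≠ i := by
    ext x
    simp only [Finset.mem_filter, Finset.mem_univ, true_and, and_iff_right_iff_imp]
    intro h
    simpa using hmem _ h
  have hsum := T.card_filter_add_card_filter_not (fun x => col (σ x) = i)
  rw [hfil, card_filter_col_ne hm, hcard] at hsum
  have hpair : ({y, z} : Finset V) = T.filter fun x => col (σ x) = i := by
    apply Finset.eq_of_subset_of_card_le
    · intro x hx
      rcases Finset.mem_insert.1 hx with rfl | hx
      · simp [hy, hyi]
      · rw [Finset.mem_singleton.1 hx]; simp [hz, hzi]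
    · rw [Finset.card_pair hyz]; omega
  refine reachable_swap_of_claw (yp := σ.symm p) (yq := σ.symm q) hY hconn.preconnected
    (Finset.mem_coe.2 hx) ha₁ ha₂ ha₃ h₁ h₂ h₃ h₁₂ h₁₃ h₂₃
    (Finset.mem_coe.2 hy) hz (hmem p hp) (hmem q hq) hyz hyi hzi (by simpa) (by simpa) (by simpa)
    fun w hw hwi => ?_
  have : w ∈ ({y, z} : Finset V) := by rw [hpair]; simp [Finset.mem_coe.1 hw, hwi]
  simpa using this

/-- For `b` outside `T`, a person of class `i` is sent to the one seat of `T \ T₁`, so that all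
outsiders sit in `T₁` while `b` is undisturbed. Induction links `b` to some `z` in `T ∩ T₁`, and an
exchange inside `T` links the person at `z` to the one at `y`. -/
lemma reachable_swap_of_chain (hY : ∀ p q, Y.Adj p q ↔ col p ≠ col q)
    (hm : (Finset.univ.filter fun w => col w ≠ i).card = m)
    (hpq : ∃ p q, col p ≠ i ∧ col q ≠ i ∧ col p ≠ col q) {T T' : Finset V}
    (hT' : IsForked X (m + 2) T')
    (hchain : Relation.ReflTransGen (ForkedStep X (m + 2)) T T') {b : V} (hb : b ∈ T') :
    ∀ {σ : V ≃ W}, (∀ x ∉ T, col (σ x) = i) → col (σ b) = i → ∀ {y}, y ∈ T → col (σ y) = i →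
      (FS X Y).Reachable σ (σ.trans (Equiv.swap (σ b) (σ y))) := by
  induction hchain using Relation.ReflTransGen.head_induction_on with
  | refl =>
    intro σ hσ hbi y hy hyi
    exact reachable_swap_of_mem_isForked hY hm hpq hT' hσ hb hy hbi hyi
  | @head T T₁ hstep _ ih =>
    intro σ hσ hbi y hy hyi
    obtain ⟨hT, hT₁, hcap⟩ := hstep
    by_cases hbT : b ∈ T
    · exact reachable_swap_of_mem_isForked hY hm hpq hT hσ hbT hy hbi hyi
    have hdiff : (T \ T₁).card = 1 := by
      have := Finset.card_sdiff_add_card_inter T T₁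
      have := hT.1
      omega
    obtain ⟨a, ha⟩ := Finset.card_eq_one.1 hdiff
    have haT : a ∈ T := by
      have : a ∈ T \ T₁ := by simp [ha]
      exact (Finset.mem_sdiff.1 this).1
    obtain ⟨τ, hτ, hout, hcol⟩ := exists_reachable_recolour (fun p q h => (hY p q).2 h)
      hT.2.1.preconnected (Equiv.swap a y) (fun x hx => Equiv.swap_apply_of_ne_of_ne
        (by rintro rfl; exact hx haT) (by rintro rfl; exact hx hy)) σ
    have hτi : ∀ x ∉ T₁, col (τ x) = i := by
      intro x hx
      by_cases hxT : x ∈ T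
      · have : x ∈ T \ T₁ := Finset.mem_sdiff.2 ⟨hxT, hx⟩
        rw [ha, Finset.mem_singleton] at this
        rw [this, hcol, Equiv.swap_apply_left, hyi]
      · rw [hout x hxT, hσ x hxT]
    have hτb : τ b = σ b := hout b hbT
    -- `T ∩ T₁` has `m + 1` seats, one more than there are outsiders.
    obtain ⟨z, hz, hzi⟩ := exists_col_eq_of_lt_card hm τ (S := T ∩ T₁) (by omega)
    obtain ⟨hzT, hzT₁⟩ := Finset.mem_inter.1 hz
    have h₁ := ih hτi (by rw [hτb, hbi]) hzT₁ hzi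
    rw [hτb] at h₁
    have h₁' := reachable_swap_of_reachable hY (hbi.trans hzi.symm) hτ h₁
    -- Recolouring leaves people outside `T` in place, so the person now at `z` sat in `T` before.
    have hz' : σ.symm (τ z) ∈ T := by
      by_contra h
      have h2 := hout _ h
      rw [Equiv.apply_symm_apply] at h2
      exact h (by rwa [τ.injective h2])
    have h₂ := reachable_swap_of_mem_isForked hY hm hpq hT hσ hz' hy (by simpa) hyi
    rw [Equiv.apply_symm_apply] at h₂
    exact reachable_swap_trans hY (hbi.trans hzi.symm) (hzi.trans hyi.symm) h₁' h₂

/-- If every vertex is covered by a forked set that is linked to a fixed one, then people of class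
`i` can be exchanged from every arrangement. -/
lemma reachable_swap_of_cover (hY : ∀ p q, Y.Adj p q ↔ col p ≠ col q)
    (hm : (Finset.univ.filter fun w => col w ≠ i).card = m)
    (hpq : ∃ p q, col p ≠ i ∧ col q ≠ i ∧ col p ≠ col q) (hX : X.Preconnected) {T : Finset V}
    (hT : IsForked X (m + 2) T)
    (hcover : ∀ b, ∃ T', IsForked X (m + 2) T' ∧
      Relation.ReflTransGen (ForkedStep X (m + 2)) T T' ∧ b ∈ T')
    (σ : V ≃ W) {u v : W} (hu : col u = i) (hv : col v = i) :
    (FS X Y).Reachable σ (σ.trans (Equiv.swap u v)) := by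
  -- Gather all outsiders in `T`; everybody of class `i` is then exchangeable with one person at
  -- `y`, hence with each other.
  obtain ⟨S, hST, hS⟩ := Finset.exists_subset_card_eq (s := T) (n := m) (by have := hT.1; omega)
  have hcard := card_filter_col_ne hm σ
  let e : {x // x ∈ S} ≃ {x // x ∈ Finset.univ.filter fun x => col (σ x) ≠ i} :=
    Finset.equivOfCardEq (hS.trans hcard.symm)
  have huniv : (X.induce (Set.univ : Set V)).Preconnected :=
    (Iso.preconnected_iff (induceUnivIso X)).2 hX
  obtain ⟨τ, hτ, -, hcol⟩ := exists_reachable_recolour (fun p q h => (hY p q).2 h)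
    huniv e.extendSubtype (fun x hx => absurd (Set.mem_univ x) hx) σ
  have hτi : ∀ x ∉ T, col (τ x) = i := by
    intro x hx
    have := e.extendSubtype_not_mem x (fun h => hx (hST h))
    rw [hcol]
    simpa using this
  obtain ⟨y, hy, hyi⟩ := exists_col_eq_of_lt_card hm τ (S := T) (by have := hT.1; omega)
  have key : ∀ w, col w = i → (FS X Y).Reachable τ (τ.trans (Equiv.swap w (τ y))) := by
    intro w hw
    obtain ⟨T', hT', hch, hb⟩ := hcover (τ.symm w)
    have := reachable_swap_of_chain hY hm hpq hT' hch hb hτi (by simpa) hy hyi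
    rwa [Equiv.apply_symm_apply] at this
  have hv' := key v hv
  rw [Equiv.swap_comm] at hv'
  exact reachable_swap_of_reachable hY (hu.trans hv.symm) hτ
    (reachable_swap_trans hY (hu.trans hyi.symm) (hyi.trans hv.symm) (key u hu) hv')

end Propagation

/-- Neighbours in `X` hold either friends, who swap directly, or two people of one class, for whom
exchanging people and exchanging seats are the same. -/
lemma preconnected_of_reachable_swap {V W ι : Type*} [Finite V] [DecidableEq V] [DecidableEq W]
    {X : SimpleGraph V} {Y : SimpleGraph W} {col : W → ι} (hY : ∀ p q, Y.Adj p q ↔ col p ≠ col q)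
    (hX : X.Preconnected)
    (h : ∀ (σ : V ≃ W) (u v : W), u ≠ v → col u = col v →
      (FS X Y).Reachable σ (σ.trans (Equiv.swap u v))) : (FS X Y).Preconnected := by
  have huniv : (X.induce (Set.univ : Set V)).Preconnected :=
    (Iso.preconnected_iff (induceUnivIso X)).2 hX
  have key : ∀ π : Equiv.Perm V, ∀ σ : V ≃ W, (FS X Y).Reachable σ (π.trans σ) := by
    intro π
    refine perm_induction_of_preconnected
      (P := fun π => ∀ σ : V ≃ W, (FS X Y).Reachable σ (π.trans σ)) huniv ?_ ?_ ?_ π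
      (fun x hx => absurd (Set.mem_univ x) hx)
    · exact fun σ => .refl _
    · exact fun π ρ h1 h2 σ => (h1 σ).trans (h2 _)
    · intro a _ b _ hab σ
      by_cases hc : col (σ a) = col (σ b)
      · have := h σ _ _ (σ.injective.ne hab.ne) hc
        convert this using 1
        ext x
        simp only [Equiv.trans_apply, Equiv.swap_apply_def, EmbeddingLike.apply_eq_iff_eq]
        split_ifs <;> rfl
      · exact (adj_swap_trans hab ((hY _ _).2 hc)).reachable
  intro σ τ
  have := key (τ.trans σ.symm) σ
  rwa [Equiv.trans_assoc, Equiv.symm_trans_self, Equiv.trans_refl] at this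

/-! ### Connected sets and paths in forests -/

section Trees

variable {V : Type*} {X : SimpleGraph V}

lemma connected_induce_insert [DecidableEq V] {T : Finset V} {v b : V}
    (hT : (X.induce (T : Set V)).Connected) (hv : v ∈ T) (hvb : X.Adj v b) :
    (X.induce ((insert b T : Finset V) : Set V)).Connected := by
  have h := connected_induce_union hT.preconnected
    (induce_pair_connected_of_adj hvb).preconnected (Finset.mem_coe.2 hv) (Set.mem_insert_of_mem v rfl) hvb
  rwa [show ((insert b T : Finset V) : Set V) = (T : Set V) ∪ ({v, b} : Set V) by
    ext x
    simp only [Finset.coe_insert, Set.mem_insert_iff, Finset.mem_coe, Set.mem_union,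
      Set.mem_singleton_iff]
    grind]

lemma connected_induce_support [DecidableEq V] {u v : V} (p : X.Walk u v) :
    (X.induce (p.support.toFinset : Set V)).Connected := by
  have := p.connected_induce_support
  rwa [show (p.support.toFinset : Set V) = {v | v ∈ p.support} by ext; simp]

lemma exists_adj_mem_sdiff {K R : Set V} (hR : (X.induce R).Preconnected) (hKR : K ⊆ R)
    (hK : K.Nonempty) (hne : ¬ R ⊆ K) : ∃ y ∈ K, ∃ z ∈ R, z ∉ K ∧ X.Adj y z := by
  obtain ⟨a, ha⟩ := hK
  obtain ⟨b, hb, hbK⟩ := Set.not_subset.1 hne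
  obtain ⟨p⟩ := hR ⟨a, hKR ha⟩ ⟨b, hb⟩
  obtain ⟨d, -, h1, h2⟩ := p.exists_boundary_dart (Subtype.val ⁻¹' K) ha hbK
  exact ⟨d.fst, h1, d.snd, d.snd.2, h2, d.adj⟩

/-- While the set is smaller than `R`, connectedness of `R` supplies a boundary edge and so one more
vertex. -/
lemma exists_connected_card_eq [DecidableEq V] {Q R : Finset V}
    (hQ : (X.induce (Q : Set V)).Connected) (hR : (X.induce (R : Set V)).Connected) (hQR : Q ⊆ R)
    {k : ℕ} (hk : Q.card ≤ k) (hk' : k ≤ R.card) :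
    ∃ K : Finset V, Q ⊆ K ∧ K ⊆ R ∧ (X.induce (K : Set V)).Connected ∧ K.card = k := by
  induction k, hk using Nat.le_induction with
  | base => exact ⟨Q, subset_rfl, hQR, hQ, rfl⟩
  | succ k _ ih =>
    obtain ⟨K, h1, h2, h3, h4⟩ := ih (by omega)
    obtain ⟨y, hy, z, hz, hzK, hyz⟩ := exists_adj_mem_sdiff hR.preconnected
      (Finset.coe_subset.2 h2) (Set.nonempty_coe_sort.1 h3.nonempty) (fun h => by
        have := Finset.card_le_card (Finset.coe_subset.1 h)
        omega)
    have hzK' : z ∉ K := hzK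
    exact ⟨insert z K, h1.trans (Finset.subset_insert _ _), Finset.insert_subset hz h2,
      connected_induce_insert h3 hy hyz, by rw [Finset.card_insert_of_notMem hzK', h4]⟩

/-- An interior vertex of a path has two neighbours on the path. -/
lemma exists_adj_adj_of_mem_support {u v y : V} {p : X.Walk u v} (hp : p.IsPath)
    (hy : y ∈ p.support) (hyu : y ≠ u) (hyv : y ≠ v) :
    ∃ c ∈ p.support, ∃ d ∈ p.support, c ≠ d ∧ X.Adj y c ∧ X.Adj y d ∧
      (X.IsAcyclic → ∀ z ∈ p.support, X.Adj y z → z = c ∨ z = d) := by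
  classical
  obtain ⟨p₁, p₂, h₁, h₂, rfl⟩ := hp.mem_support_iff_exists_append.mp hy
  have n₁ : ¬ p₁.Nil := fun h => hyu h.eq.symm
  have n₂ : ¬ p₂.Nil := fun h => hyv h.eq
  have a₁ := p₁.adj_penultimate n₁
  have a₂ := p₂.adj_snd n₂
  refine ⟨p₁.penultimate, ?_, p₂.snd, ?_, ?_, a₁.symm, a₂, ?_⟩
  · exact Walk.mem_support_append_iff _ _ |>.2 (.inl (p₁.getVert_mem_support _))
  · exact Walk.mem_support_append_iff _ _ |>.2 (.inr (p₂.getVert_mem_support _))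
  · exact hp.ne_of_mem_support_of_append a₂.ne' (p₁.getVert_mem_support _)
      (p₂.getVert_mem_support _)
  · intro hX z hz hyz
    rcases (Walk.mem_support_append_iff _ _).1 hz with hz | hz
    · exact .inl (hX.eq_penultimate_of_adj_end h₁ hyz hz)
    · exact .inr (hX.eq_snd_of_adj_start h₂ hyz hz)

/-- Otherwise the edge `u b` and the detour through `y` would be two paths from `u` to `b`. -/
lemma not_adj_start_of_notMem_support (hX : X.IsAcyclic) {u v y b : V} {p : X.Walk u v}
    (hp : p.IsPath) (hy : y ∈ p.support) (hyu : y ≠ u) (hyb : X.Adj y b) (hb : b ∉ p.support) :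
    ¬ X.Adj u b := by
  classical
  intro hub
  have hpath : ((p.takeUntil y hy).concat hyb).IsPath :=
    (hp.takeUntil hy).concat (fun h => hb (p.support_takeUntil_subset_support hy h)) hyb
  have h := congrArg (fun q : X.Path u b => q.1.length)
    ((hX.subsingleton_path u b).elim ⟨_, hpath⟩ (.singleton hub))
  have : (p.takeUntil y hy).length = 0 := by simpa using h
  exact hyu (Walk.eq_of_length_eq_zero this).symm

end Trees

/-! ### What the absence of a bridge gives -/

section NoBridge

variable {V : Type*} [Fintype V] {X : SimpleGraph V} [DecidableRel X.Adj]

lemma degree_ne_one {y c d : V} (hcd : c ≠ d) (hc : X.Adj y c) (hd : X.Adj y d) :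
    X.degree y ≠ 1 := by
  intro h
  obtain ⟨e, he⟩ := Finset.card_eq_one.1 h
  have h1 : c ∈ X.neighborFinset y := by simpa
  have h2 : d ∈ X.neighborFinset y := by simpa
  rw [he, Finset.mem_singleton] at h1 h2
  exact hcd (h1.trans h2.symm)

/-- An interior vertex of a path in a forest that does not have degree two has a neighbour off the
path. -/
lemma exists_adj_notMem_support (hX : X.IsAcyclic) {u v y : V} {p : X.Walk u v} (hp : p.IsPath)
    (hy : y ∈ p.support) (hyu : y ≠ u) (hyv : y ≠ v) (hdeg : X.degree y ≠ 2) :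
    ∃ c ∈ p.support, ∃ d ∈ p.support, ∃ b ∉ p.support, c ≠ d ∧ X.Adj y c ∧ X.Adj y d ∧
      X.Adj y b := by
  classical
  obtain ⟨c, hc, d, hd, hcd, hyc, hyd, hall⟩ := exists_adj_adj_of_mem_support hp hy hyu hyv
  by_contra! h
  refine hdeg ?_
  have : X.neighborFinset y = {c, d} := by
    ext z
    simp only [mem_neighborFinset, Finset.mem_insert, Finset.mem_singleton]
    constructor
    · intro hz
      by_cases hzp : z ∈ p.support
      · exact hall hX z hzp hz
      · exact absurd hz (h c hc d hd z hzp hcd hyc hyd)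
    · rintro (rfl | rfl) <;> assumption
  rw [← card_neighborFinset_eq_degree, this, Finset.card_pair hcd]

/-- In a tree without a `k`-bridge every path on `m ≥ k` vertices whose ends are not leaves has an
interior vertex that does not have degree two. -/
lemma exists_degree_ne_two_of_not_containsBridge (hX : X.IsAcyclic) {k m : ℕ} (hk : 2 ≤ k)
    (hkm : k ≤ m) (hB : ¬ ContainsBridge X k) {u v : V} {p : X.Walk u v} (hp : p.IsPath)
    (hlen : p.length + 1 = m) (hu : X.degree u ≠ 1) (hv : X.degree v ≠ 1) :
    ∃ y ∈ p.support, y ≠ u ∧ y ≠ v ∧ X.degree y ≠ 2 := by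
  by_contra! h
  have hinj : ∀ {i j}, i ≤ p.length → j ≤ p.length → p.getVert i = p.getVert j → i = j :=
    fun hi hj hij => hp.getVert_injOn hi hj hij
  -- The first `k` vertices form a bridge: the new end is either `v` or an interior vertex of `p`,
  -- of degree two.
  refine hB (.inr ⟨hk, u, _, p.take (k - 1), hp.take _, ?_, ?_, ?_, hu, ?_⟩)
  · rw [Walk.length_support, Walk.take_length]; omega
  · exact fun e he => isAcyclic_iff_forall_isBridge.1 hX (Walk.edges_subset_edgeSet _ he)
  · intro x hx hxu hxe
    obtain ⟨j, rfl, hj⟩ := Walk.mem_support_iff_exists_getVert.1 hx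
    rw [Walk.take_length] at hj
    rw [Walk.take_getVert] at hxu hxe ⊢
    refine h _ (p.getVert_mem_support _) hxu fun hxv => hxe ?_
    have := hinj (i := (k - 1) ⊓ j) (j := p.length) (by omega) le_rfl (by simpa using hxv)
    congr 1
    omega
  · rcases eq_or_lt_of_le hkm with rfl | hlt
    · rwa [show k - 1 = p.length by omega, Walk.getVert_length]
    · rw [h _ (p.getVert_mem_support _) (fun e => ?_) (fun e => ?_)]
      · norm_num
      · have := hinj (i := k - 1) (j := 0) (by omega) (by omega) (by simpa using e)
        omega
      · have := hinj (i := k - 1) (j := p.length) (by omega) (by omega) (by simpa using e)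
        omega

end NoBridge

/-! ### Covering the tree by a chain of forked sets -/

section Cover

variable {V : Type*} [DecidableEq V] {X : SimpleGraph V} {m : ℕ}

lemma forkedStep_of_subset_insert {k : ℕ} {T T' : Finset V} {z : V} (hT : IsForked X k T)
    (hT' : IsForked X k T') (hz : z ∉ T) (hz' : z ∈ T') (hsub : T' ⊆ insert z T) :
    ForkedStep X k T T' := by
  refine ⟨hT, hT', ?_⟩
  have : T ∩ T' = T'.erase z := by
    ext x
    have := @hsub x
    simp only [Finset.mem_inter, Finset.mem_erase, Finset.mem_insert] at *
    constructor
    · rintro ⟨h1, h2⟩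
      exact ⟨by rintro rfl; exact hz h1, h2⟩
    · rintro ⟨h1, h2⟩
      exact ⟨(this h2).resolve_left h1, h2⟩
  rw [this, Finset.card_erase_add_one hz', hT'.1]

lemma exists_pair_ne_of_three {a₁ a₂ a₃ : V} (s : V) (h₁₂ : a₁ ≠ a₂) (h₁₃ : a₁ ≠ a₃)
    (h₂₃ : a₂ ≠ a₃) :
    ∃ e₁ ∈ ({a₁, a₂, a₃} : Set V), ∃ e₂ ∈ ({a₁, a₂, a₃} : Set V), e₁ ≠ e₂ ∧ e₁ ≠ s ∧ e₂ ≠ s := by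
  by_cases h1 : a₁ = s
  · exact ⟨a₂, by simp, a₃, by simp, h₂₃, h1 ▸ h₁₂.symm, h1 ▸ h₁₃.symm⟩
  by_cases h2 : a₂ = s
  · exact ⟨a₁, by simp, a₃, by simp, h₁₃, h1, h2 ▸ h₂₃.symm⟩
  · exact ⟨a₁, by simp, a₂, by simp, h₁₂, h1, h2⟩

variable [Fintype V] [DecidableRel X.Adj]

lemma exists_chain_of_adj (hX : X.IsTree) (hm : 2 ≤ m)
    (hB : ∀ {u v : V} {p : X.Walk u v}, p.IsPath → p.length + 1 = m → X.degree u ≠ 1 →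
      X.degree v ≠ 1 → ∃ y ∈ p.support, y ≠ u ∧ y ≠ v ∧ X.degree y ≠ 2)
    {T : Finset V} (hT : IsForked X (m + 2) T) {v b : V} (hv : v ∈ T) (hvb : X.Adj v b) :
    ∃ T', IsForked X (m + 2) T' ∧ Relation.ReflTransGen (ForkedStep X (m + 2)) T T' ∧ b ∈ T' := by
  have hac := hX.isAcyclic
  by_cases hb : b ∈ T
  · exact ⟨T, hT, .refl, hb⟩
  have hT₀ := hT
  obtain ⟨hcard, hconn, x, hx, a₁, ha₁, a₂, ha₂, a₃, ha₃, h₁, h₂, h₃, h₁₂, h₁₃, h₂₃⟩ := hT₀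
  obtain ⟨q, hq, hqT⟩ : ∃ q : X.Walk x v, q.IsPath ∧ ∀ z ∈ q.support, z ∈ T := by
    obtain ⟨q, hq⟩ := hconn.preconnected.exists_isPath ⟨x, hx⟩ ⟨v, hv⟩
    have hs : ∀ z ∈ (q.map (Embedding.induce (T : Set V)).toHom).support, z ∈ T := by
      intro z hz
      rw [Walk.support_map, List.mem_map] at hz
      obtain ⟨w, -, rfl⟩ := hz
      exact w.2
    exact ⟨_, hq.map (f := (Embedding.induce (T : Set V)).toHom) Subtype.val_injective, hs⟩
  have hbq : b ∉ q.support := fun h => hb (hqT b h)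
  have hp : (q.concat hvb).IsPath := hq.concat hbq hvb
  set p := q.concat hvb with hpdef
  have hpnil : ¬ p.Nil := fun h => hb (h.eq ▸ hx)
  have hps : ∀ z, z ∈ p.support ↔ z ∈ q.support ∨ z = b := by
    intro z
    rw [hpdef, Walk.support_concat]
    simp
  have hplen : p.length = q.length + 1 := Walk.length_concat _ _
  have hsnd := p.adj_snd hpnil
  obtain ⟨e₁, he₁, e₂, he₂, hne, hs₁, hs₂⟩ := exists_pair_ne_of_three p.snd h₁₂ h₁₃ h₂₃
  have hadj : ∀ e ∈ ({a₁, a₂, a₃} : Set V), e ∈ T ∧ X.Adj x e := by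
    rintro e (rfl | rfl | rfl) <;> constructor <;> assumption
  obtain ⟨he₁T, hxe₁⟩ := hadj e₁ he₁
  obtain ⟨he₂T, hxe₂⟩ := hadj e₂ he₂
  have he₁p : e₁ ∉ p.support := fun h => hs₁ (hac.eq_snd_of_adj_start hp hxe₁ h)
  have he₂p : e₂ ∉ p.support := fun h => hs₂ (hac.eq_snd_of_adj_start hp hxe₂ h)
  obtain ⟨Q, hQ⟩ : ∃ Q, Q = insert e₁ (insert e₂ p.support.toFinset) := ⟨_, rfl⟩
  have hQcard : Q.card = p.length + 3 := by
    rw [hQ, Finset.card_insert_of_notMem (by simp [hne, he₁p]),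
      Finset.card_insert_of_notMem (by simpa), List.toFinset_card_of_nodup hp.support_nodup,
      Walk.length_support]
  have hQconn : (X.induce (Q : Set V)).Connected := by
    rw [hQ]
    refine connected_induce_insert (connected_induce_insert (connected_induce_support p)
      (v := x) (by simp) hxe₂) (v := x) (by simp) hxe₁
  have hQR : Q ⊆ insert b T := by
    intro z hz
    rw [hQ] at hz
    simp only [Finset.mem_insert, List.mem_toFinset, hps] at hz ⊢
    rcases hz with rfl | rfl | hz | rfl
    · exact .inr he₁T
    · exact .inr he₂T
    · exact .inr (hqT z hz)
    · exact .inl rfl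
  have hRcard : (insert b T).card = m + 3 := by
    rw [Finset.card_insert_of_notMem hb, hcard]
  -- `Q` contains `b` and a claw at `x`. If it is small enough, enlarging it within `T ∪ {b}` to `m
  -- + 2` vertices reaches `b` in one step.
  by_cases hlt : Q.card ≤ m + 2
  · obtain ⟨K, hQK, hKR, hKconn, hKcard⟩ := exists_connected_card_eq hQconn
      (connected_induce_insert hconn hv hvb) hQR hlt (by omega)
    have hbK : b ∈ K := hQK (by simp [hQ, hps])
    have hK : IsForked X (m + 2) K := ⟨hKcard, hKconn, x, hQK (by simp [hQ]), e₁,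
      hQK (by simp [hQ]), e₂, hQK (by simp [hQ]), p.snd, hQK (by
        rw [hQ]; simp [p.getVert_mem_support]), hxe₁, hxe₂, hsnd, hne, hs₁, hs₂⟩
    exact ⟨K, hK, .single (forkedStep_of_subset_insert hT hK hb hbK hKR), hbK⟩
  -- The tight case: `T` is the path `q`, on `m` vertices, together with `e₁` and `e₂`.
  have hQeq : Q = insert b T := Finset.eq_of_subset_of_card_le hQR (by omega)
  have hqlen : q.length + 1 = m := by
    rw [hQeq, hRcard] at hQcard
    omega
  have hTsub : ∀ z ∈ T, z = e₁ ∨ z = e₂ ∨ z ∈ q.support := by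
    intro z hz
    have : z ∈ Q := hQeq ▸ Finset.mem_insert_of_mem hz
    rw [hQ] at this
    simp only [Finset.mem_insert, List.mem_toFinset, hps] at this
    rcases this with h | h | h | rfl
    · exact .inl h
    · exact .inr (.inl h)
    · exact .inr (.inr h)
    · exact absurd hz hb
  have hqnil : ¬ q.Nil := fun h => by
    rw [← Walk.length_eq_zero_iff] at h
    omega
  obtain ⟨y, hy, hyx, hyv, hyd⟩ := hB hq hqlen (degree_ne_one hne hxe₁ hxe₂)
    (degree_ne_one (c := b) (d := q.penultimate)
      (fun h => hbq (h ▸ q.getVert_mem_support _)) hvb (q.adj_penultimate hqnil).symm)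
  obtain ⟨c, hc, d, hd, b', hb', hcd, hyc, hyd, hyb'⟩ :=
    exists_adj_notMem_support hac hq hy hyx hyv hyd
  have hxb' := not_adj_start_of_notMem_support hac hq hy hyx hyb' hb'
  have hb'e₁ : b' ≠ e₁ := fun h => hxb' (h ▸ hxe₁)
  have hb'e₂ : b' ≠ e₂ := fun h => hxb' (h ▸ hxe₂)
  have hb'T : b' ∉ T := fun h => by
    rcases hTsub b' h with h | h | h <;> contradiction
  have hmem : ∀ z, z ∈ q.support.toFinset ↔ z ∈ q.support := fun z => List.mem_toFinset
  -- The claw moves to `y`, with its two path neighbours and `b'` as leaves. First `b'` replaces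
  -- `e₁`, then `b` replaces `e₂`.
  have hforked : ∀ {z e : V}, z ∈ q.support → X.Adj z e → e ∉ q.support → e ≠ b' →
      IsForked X (m + 2) (insert e (insert b' q.support.toFinset)) := by
    intro z e hz hze he heb'
    refine ⟨?_, ?_, y, by simp [hy], c, by simp [hc], d, by simp [hd], b', by simp, hyc, hyd, hyb',
      hcd, fun h => hb' (h ▸ hc), fun h => hb' (h ▸ hd)⟩
    · rw [Finset.card_insert_of_notMem (by simp [heb', he]),
        Finset.card_insert_of_notMem (by simpa), List.toFinset_card_of_nodup hq.support_nodup,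
        Walk.length_support]
      omega
    · exact connected_induce_insert (connected_induce_insert (connected_induce_support q)
        (v := y) (by simp [hy]) hyb') (v := z) (by simp [hz]) hze
  have he₂q : e₂ ∉ q.support := fun h => he₂p ((hps _).2 (.inl h))
  have hT₁ := hforked q.start_mem_support hxe₂ he₂q hb'e₂.symm
  have step₁ := forkedStep_of_subset_insert hT hT₁ hb'T (by simp) (by
    intro z hz
    simp only [Finset.mem_insert, List.mem_toFinset] at hz ⊢
    rcases hz with rfl | rfl | hz
    · exact .inr he₂T
    · exact .inl rfl
    · exact .inr (hqT z hz))
  by_cases hbb' : b = b'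
  · exact ⟨_, hT₁, .single step₁, by simp [hbb']⟩
  have hT₂ := hforked q.end_mem_support hvb hbq hbb'
  have step₂ := forkedStep_of_subset_insert hT₁ hT₂ (z := b)
    (by
      simp only [Finset.mem_insert, List.mem_toFinset, not_or]
      exact ⟨fun h => hb (h ▸ he₂T), hbb', hbq⟩)
    (by simp) (by
      intro z hz
      simp only [Finset.mem_insert, List.mem_toFinset] at hz ⊢
      tauto)
  exact ⟨_, hT₂, .tail (.single step₁) step₂, by simp⟩

lemma exists_chain_to_vertex (hX : X.IsTree) (hm : 2 ≤ m)
    (hB : ∀ {u v : V} {p : X.Walk u v}, p.IsPath → p.length + 1 = m → X.degree u ≠ 1 →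
      X.degree v ≠ 1 → ∃ y ∈ p.support, y ≠ u ∧ y ≠ v ∧ X.degree y ≠ 2)
    {T : Finset V} (hT : IsForked X (m + 2) T) (b : V) :
    ∃ T', IsForked X (m + 2) T' ∧ Relation.ReflTransGen (ForkedStep X (m + 2)) T T' ∧ b ∈ T' := by
  obtain ⟨a, ha⟩ := Set.nonempty_coe_sort.1 hT.2.1.nonempty
  obtain ⟨p⟩ := hX.connected.preconnected b a
  induction p with
  | nil => exact ⟨T, hT, .refl, ha⟩
  | cons huv _ ih =>
    obtain ⟨T₁, hT₁, h₁, hv⟩ := ih ha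
    obtain ⟨T₂, hT₂, h₂, hu⟩ := exists_chain_of_adj hX hm hB hT₁ hv huv.symm
    exact ⟨T₂, hT₂, h₁.trans h₂, hu⟩

/-- If a longest path misses a vertex, the tree branches off it, by maximality not at an end. If it
is spanning, `hB` applied to a subpath avoiding both ends yields a branch vertex. -/
lemma exists_three_adj (hX : X.IsTree) (hm : 2 ≤ m) (hn : m + 2 ≤ Fintype.card V)
    (hB : ∀ {u v : V} {p : X.Walk u v}, p.IsPath → p.length + 1 = m → X.degree u ≠ 1 →
      X.degree v ≠ 1 → ∃ y ∈ p.support, y ≠ u ∧ y ≠ v ∧ X.degree y ≠ 2) :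
    ∃ x a₁ a₂ a₃ : V, X.Adj x a₁ ∧ X.Adj x a₂ ∧ X.Adj x a₃ ∧ a₁ ≠ a₂ ∧ a₁ ≠ a₃ ∧ a₂ ≠ a₃ := by
  have := hX.connected.nonempty
  obtain ⟨u, v, p, hp, hmax⟩ := Walk.exists_isPath_forall_isPath_length_le_length X
  by_cases hall : ∀ z, z ∈ p.support
  · have hlen : Fintype.card V ≤ p.length + 1 := by
      rw [← Walk.length_support, ← List.toFinset_card_of_nodup hp.support_nodup,
        Finset.eq_univ_of_forall (s := p.support.toFinset) (by simpa using hall),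
        Finset.card_univ]
    have hinj : ∀ {i j}, i ≤ p.length → j ≤ p.length → p.getVert i = p.getVert j → i = j :=
      fun hi hj hij => hp.getVert_injOn hi hj hij
    have hend : ∀ i, 0 < i → i < p.length → X.degree (p.getVert i) ≠ 1 := by
      intro i h0 h1
      obtain ⟨c, -, d, -, hcd, hc, hd, -⟩ := exists_adj_adj_of_mem_support hp
        (p.getVert_mem_support i)
        (fun e => by
          have := hinj (i := i) (j := 0) h1.le (by omega) (by simpa using e)
          omega)
        (fun e => by
          have := hinj (i := i) (j := p.length) h1.le le_rfl (by simpa using e)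
          omega)
      exact degree_ne_one hcd hc hd
    -- These are vertices `1, …, m` of `p`; since `p` has at least `m + 2` vertices, both ends are
    -- interior to `p`.
    have hq : ((p.drop 1).take (m - 1)).IsPath := (hp.drop 1).take _
    obtain ⟨y, hy, hyu, hyv, hyd⟩ := hB hq (by rw [Walk.take_length, Walk.drop_length]; omega)
      (hend 1 (by omega) (by omega))
      (by rw [Walk.drop_getVert]; exact hend _ (by omega) (by omega))
    obtain ⟨c, hc, d, hd, b, hb, hcd, hyc, hyd, hyb⟩ :=
      exists_adj_notMem_support hX.isAcyclic hq hy hyu hyv hyd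
    exact ⟨y, c, d, b, hyc, hyd, hyb, hcd, fun h => hb (h ▸ hc), fun h => hb (h ▸ hd)⟩
  · push Not at hall
    obtain ⟨z, hz⟩ := hall
    obtain ⟨w⟩ := hX.connected.preconnected u z
    obtain ⟨e, -, h1, h2⟩ := w.exists_boundary_dart {z | z ∈ p.support} p.start_mem_support hz
    have h1 : e.fst ∈ p.support := h1
    have h2 : e.snd ∉ p.support := h2
    have hadj := e.adj
    generalize e.fst = y at *
    generalize e.snd = b at *
    by_cases hyu : y = u
    · subst hyu
      have := hmax _ _ _ (hp.cons (h := hadj.symm) h2)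
      simp at this
    by_cases hyv : y = v
    · subst hyv
      have := hmax _ _ _ (hp.concat h2 hadj)
      simp at this
    obtain ⟨c, hc, d, hd, hcd, hyc, hyd, -⟩ := exists_adj_adj_of_mem_support hp h1 hyu hyv
    exact ⟨y, c, d, b, hyc, hyd, hadj, hcd, fun h => h2 (h ▸ hc), fun h => h2 (h ▸ hd)⟩

lemma exists_isForked (hX : X.IsTree) (hm : 2 ≤ m) (hn : m + 2 ≤ Fintype.card V)
    (hB : ∀ {u v : V} {p : X.Walk u v}, p.IsPath → p.length + 1 = m → X.degree u ≠ 1 →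
      X.degree v ≠ 1 → ∃ y ∈ p.support, y ≠ u ∧ y ≠ v ∧ X.degree y ≠ 2) :
    ∃ T, IsForked X (m + 2) T := by
  obtain ⟨x, a₁, a₂, a₃, h₁, h₂, h₃, h₁₂, h₁₃, h₂₃⟩ := exists_three_adj hX hm hn hB
  have huniv : (X.induce ((Finset.univ : Finset V) : Set V)).Connected := by
    rw [Finset.coe_univ]
    exact (Iso.connected_iff (induceUnivIso X)).2 hX.connected
  have hbase : (X.induce (({x} : Finset V) : Set V)).Connected := by
    have := connected_induce_support (Walk.nil : X.Walk x x)
    rwa [show (Walk.nil : X.Walk x x).support.toFinset = {x} by simp] at this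
  have hQ := connected_induce_insert (connected_induce_insert (connected_induce_insert hbase
    (v := x) (by simp) h₁) (v := x) (by simp) h₂) (v := x) (by simp) h₃
  -- The claw has at most four vertices, and `4 ≤ m + 2`.
  obtain ⟨K, hQK, -, hK, hcard⟩ := exists_connected_card_eq (k := m + 2) hQ huniv
    (Finset.subset_univ _) (by
      have := (Finset.card_insert_le a₃ (insert a₂ (insert a₁ {x})))
      have := (Finset.card_insert_le a₂ (insert a₁ {x}))
      have := (Finset.card_insert_le a₁ {x})
      have : ({x} : Finset V).card = 1 := Finset.card_singleton x
      omega) (by rwa [Finset.card_univ])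
  exact ⟨K, hcard, hK, x, hQK (by simp), a₁, hQK (by simp), a₂, hQK (by simp), a₃,
    hQK (by simp), h₁, h₂, h₃, h₁₂, h₁₃, h₂₃⟩

end Cover

end FriendsStrangers

/-! ### The theorem -/

theorem theorem1p6 {V : Type*} [Fintype V] (X : SimpleGraph V) [DecidableRel X.Adj]
    (n t : ℕ) (ht : 2 < t) (k : Fin t → ℕ) (hk_pos : ∀ i, 1 ≤ k i) (hk_mono : Monotone k)
    (hn : n = ∑ i, k i) (hn4 : 4 ≤ n) (hV : Fintype.card V = n)
    (hX : X.IsTree) (hbridge : ¬ ContainsBridge X (n - k ⟨t - 1, by omega⟩)) :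
    (FS X (SimpleGraph.completeMultipartiteGraph (fun i => Fin (k i)))).Connected := by
  classical
  set last : Fin t := ⟨t - 1, by omega⟩ with hlast
  have hY : ∀ p q : Σ i, Fin (k i),
      (SimpleGraph.completeMultipartiteGraph (fun i => Fin (k i))).Adj p q ↔ p.1 ≠ q.1 :=
    fun _ _ => Iff.rfl
  have hcard : Fintype.card V = Fintype.card (Σ i, Fin (k i)) := by
    simp [hV, hn, Fintype.card_sigma]
  have : Nonempty (V ≃ Σ i, Fin (k i)) := Fintype.card_eq.1 hcard
  refine (SimpleGraph.connected_iff _).2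
    ⟨FriendsStrangers.preconnected_of_reachable_swap (col := Sigma.fst) hY
      hX.connected.preconnected ?_, this⟩
  rintro σ u v huv hcol
  have hclass : ∀ i, (Finset.univ.filter fun w : Σ i, Fin (k i) => w.1 = i).card = k i := by
    intro i
    have : (Finset.univ.filter fun w : Σ i, Fin (k i) => w.1 = i) =
        Finset.univ.map (Function.Embedding.sigmaMk i) := by
      ext ⟨j, a⟩
      simp only [Finset.mem_filter, Finset.mem_univ, true_and, Finset.mem_map,
        Function.Embedding.sigmaMk_apply]
      constructor
      · rintro rfl
        exact ⟨a, rfl⟩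
      · rintro ⟨b, hb⟩
        exact (congrArg Sigma.fst hb).symm
    rw [this, Finset.card_map, Finset.card_univ, Fintype.card_fin]
  have hsum : ∀ i, k i + (Finset.univ.filter fun w : Σ i, Fin (k i) => w.1 ≠ i).card = n := by
    intro i
    have := Finset.card_filter_add_card_filter_not (s := Finset.univ)
      (fun w : Σ i, Fin (k i) => w.1 = i)
    rw [hclass, Finset.card_univ, ← hcard, hV] at this
    exact this
  -- This is where `t > 2` enters: it gives the two outsiders of different classes needed in the
  -- claw, and `m ≥ 2`.
  have hother : ∀ i : Fin t, ∃ j l : Fin t, j ≠ i ∧ l ≠ i ∧ j ≠ l := by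
    intro i
    obtain ⟨j, hj⟩ := Finset.exists_mem_notMem_of_card_lt_card
      (s := {i}) (t := Finset.univ) (by simp; omega)
    obtain ⟨l, hl⟩ := Finset.exists_mem_notMem_of_card_lt_card
      (s := {i, j}) (t := Finset.univ) (by
        have := Finset.card_le_two (a := i) (b := j)
        simp only [Finset.card_univ, Fintype.card_fin]
        omega)
    simp only [Finset.mem_insert, Finset.mem_singleton, not_or] at hj hl
    exact ⟨j, l, hj.2, hl.2.1, fun h => hl.2.2 h.symm⟩
  have hne : ∀ i : Fin t, ∃ p q : Σ i, Fin (k i), p.1 ≠ i ∧ q.1 ≠ i ∧ p.1 ≠ q.1 := by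
    intro i
    obtain ⟨j, l, h₁, h₂, h₃⟩ := hother i
    exact ⟨⟨j, 0, hk_pos j⟩, ⟨l, 0, hk_pos l⟩, h₁, h₂, h₃⟩
  have htwo : ∀ i, 2 ≤ (Finset.univ.filter fun w : Σ i, Fin (k i) => w.1 ≠ i).card := by
    intro i
    obtain ⟨p, q, hp, hq, hpq⟩ := hne i
    exact Finset.one_lt_card.2 ⟨p, by simpa, q, by simpa, fun h => hpq (by rw [h])⟩
  obtain ⟨m, hm⟩ : ∃ m, (Finset.univ.filter fun w : Σ i, Fin (k i) => w.1 ≠ u.1).card = m :=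
    ⟨_, rfl⟩
  -- Two distinct people in the class give `m + 2 ≤ n`, which leaves room for a forked set.
  have hku : 2 ≤ k u.1 := by
    rw [← hclass u.1]
    exact Finset.one_lt_card.2 ⟨u, by simp, v, by simp [hcol], huv⟩
  have hle : k u.1 ≤ k last := hk_mono (Fin.mk_le_mk.2 (by have := u.1.2; omega))
  have h1 := hsum u.1
  have h2 := hsum last
  have h3 := htwo u.1
  have h4 := htwo last
  rw [hm] at h1 h3
  -- The class of `u` is no larger than the last one, so `m` is at least the forbidden bridge
  -- length.
  have hB : ∀ {a b : V} {p : X.Walk a b}, p.IsPath → p.length + 1 = m → X.degree a ≠ 1 →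
      X.degree b ≠ 1 → ∃ y ∈ p.support, y ≠ a ∧ y ≠ b ∧ X.degree y ≠ 2 :=
    fun hp hlen ha hb => FriendsStrangers.exists_degree_ne_two_of_not_containsBridge hX.isAcyclic
      (by omega) (by omega) hbridge hp hlen ha hb
  obtain ⟨T, hT⟩ := FriendsStrangers.exists_isForked hX h3 (by omega) hB
  exact FriendsStrangers.reachable_swap_of_cover (col := Sigma.fst) hY hm (hne u.1)
    hX.connected.preconnected hT (FriendsStrangers.exists_chain_to_vertex hX h3 hB hT) σ rfl
    hcol.symm
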